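/- For a prime power $q$ equip $\mathbb{F}_q^n$ with the standard dot product, and call a linear code $C \le \mathbb{F}_q^n$ self-orthogonal if $C \subseteq C^\perp$. Let $\Sigma_q(n,k)$ be the set of $k$-dimensional self-orthogonal codes in $\mathbb{F}_q^n$, let $\sigma_q(n,k)=|\Sigma_q(n,k)|$, and let $w(\mathbb{F}_q^n)$ be the Witt index, i.e. the largest dimension of a self-orthogonal code in $\mathbb{F}_q^n$. For $C\neq 0$ let $d(C)$ be the minimum Hamming distance of $C$, i.e. the least Hamming weight of a nonzero codeword. Fix integers $n,d,k$ with $4 \le d<n$ and $1 \le k \le n-d+1$. Below, $q$ ranges over the prime powers with $k\le w(\mathbb{F}_q^n)$. Then \[ \frac{|\{C \in \Sigma_q(n,k) \mid d(C) \le d-1\}|}{\sigma_q(n,k)} \in O\left(q^{d+k-n-2}\right) \quad\text{as } q\to\infty, \] where the implied constant may depend on $n,d,k$ only. Moreover, a uniformly random $k$-dimensional self-orthogonal code $C\le\mathbb{F}_q^n$ is MDS, i.e. satisfies $d(C)=n-k+1$, with probability tending to $1$ as $q\to\infty$. -/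

import Mathlib

namespace SelfOrthogonalCodes

noncomputable section

/-- The dual (orthogonal) code of `C ≤ F ^ n` with respect to the standard dot product. -/
def dualCode {F : Type*} [Field F] {n : ℕ} (C : Submodule F (Fin n → F)) :
    Submodule F (Fin n → F) :=
  LinearMap.BilinForm.orthogonal (dotProductBilin F F) C

/-- A code is self-orthogonal if it is contained in its dual. -/
def IsSelfOrthogonal {F : Type*} [Field F] {n : ℕ} (C : Submodule F (Fin n → F)) : Prop :=
  C ≤ dualCode C

/-- The Witt index of `F ^ n` with the standard dot product: the largest dimension of a
self-orthogonal subspace. -/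
def wittIndex (F : Type*) [Field F] (n : ℕ) : ℕ :=
  sSup {m : ℕ | ∃ C : Submodule F (Fin n → F),
    IsSelfOrthogonal C ∧ Module.finrank F C = m}

open scoped Classical in
/-- The minimum Hamming distance of a nonzero linear code: the least Hamming weight of a
nonzero codeword. -/
def minDist {F : Type*} [Field F] {n : ℕ} (C : Submodule F (Fin n → F)) : ℕ :=
  sInf {m : ℕ | ∃ v ∈ C, v ≠ 0 ∧ hammingNorm v = m}

/-- A nonzero code is maximum distance separable if its minimum distance is `n - k + 1`, where
`k` is its dimension. -/
def IsMDS {F : Type*} [Field F] {n : ℕ} (C : Submodule F (Fin n → F)) : Prop :=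
  C ≠ ⊥ ∧ minDist C = n - Module.finrank F C + 1

/-- The set of all `k`-dimensional self-orthogonal codes in `F ^ n`. -/
def selfOrthogonalCodes (F : Type*) [Field F] (n k : ℕ) : Set (Submodule F (Fin n → F)) :=
  {C | Module.finrank F C = k ∧ IsSelfOrthogonal C}

/-- The proportion of those `k`-dimensional self-orthogonal codes in `F ^ n` that satisfy `P`,
i.e. the probability that a uniformly random such code satisfies `P` (`F` is finite and
`k` is at most the Witt index wherever this is used). -/
def proportion (F : Type*) [Field F] (n k : ℕ) (P : Submodule F (Fin n → F) → Prop) : ℝ :=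
  ({C ∈ selfOrthogonalCodes F n k | P C}.ncard : ℝ) / ((selfOrthogonalCodes F n k).ncard : ℝ)

end

end SelfOrthogonalCodes

open scoped Matrix

namespace SelfOrthogonalCodes

section

variable {F : Type*} [Field F] {n : ℕ}

/-! Double count pairs `v ∈ C` with `v` a nonzero isotropic vector of weight at most `m < n`; write
`q = |F|`, and `σ` for the number of codes. There are `O(q ^ (m - 1))` such vectors
(`card_light_isotropic_le`), and a code with `minDist C ≤ m` contains at least `q - 1` of them. Each
`v` lies in at most `2 q ^ (k + 1 - n) σ` codes (`ncard_containing_mul_le`): isometries show that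
every isotropic `u` not orthogonal to `v` lies in at least as many codes as `v`, there are at least
`q ^ (n - 1) / 2` such `u`, and a code has only `q ^ k` vectors. So the bad proportion is `O(q ^ (m
+ k - n - 1))`. Take `m = d - 1` for the first claim, and `m = n - k` with the Singleton bound for
the second. -/

lemma isSelfOrthogonal_iff {C : Submodule F (Fin n → F)} :
    IsSelfOrthogonal C ↔ ∀ v ∈ C, ∀ w ∈ C, v ⬝ᵥ w = 0 := by
  constructor
  · intro h v hv w hw
    exact h hw v hv
  · intro h w hw v hv
    exact h v hv w hw

/-! ### Isometries exchanging isotropic vectors -/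

/-- Nonorthogonal isotropic vectors are exchanged by an isometry (a reflection, or a symplectic
transvection in characteristic two). -/
lemma exists_isometry {u v : Fin n → F} (hu : u ⬝ᵥ u = 0) (hv : v ⬝ᵥ v = 0)
    (huv : u ⬝ᵥ v ≠ 0) :
    ∃ T : (Fin n → F) ≃ₗ[F] (Fin n → F), (∀ x y, T x ⬝ᵥ T y = x ⬝ᵥ y) ∧ T v = u := by
  set a : F := (u ⬝ᵥ v)⁻¹ with ha
  have ha1 : a * (u ⬝ᵥ v) = 1 := inv_mul_cancel₀ huv
  set w := u - v with hw
  have hww : w ⬝ᵥ w = -2 * (u ⬝ᵥ v) := by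
    rw [hw, sub_dotProduct, dotProduct_sub, dotProduct_sub, hu, hv, dotProduct_comm v u]
    ring
  let T : (Fin n → F) →ₗ[F] (Fin n → F) :=
    { toFun := fun x => x + (a * (x ⬝ᵥ w)) • w
      map_add' := fun x y => by rw [add_dotProduct]; module
      map_smul' := fun c x => by
        rw [smul_dotProduct, smul_eq_mul, RingHom.id_apply]; module }
  have hT : ∀ x, T x = x + (a * (x ⬝ᵥ w)) • w := fun x => rfl
  have hiso : ∀ x y, T x ⬝ᵥ T y = x ⬝ᵥ y := by
    intro x y
    rw [hT, hT]
    simp only [add_dotProduct, dotProduct_add, smul_dotProduct, dotProduct_smul, smul_eq_mul,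
      hww, dotProduct_comm w y]
    linear_combination (-2 * a * (x ⬝ᵥ w) * (y ⬝ᵥ w)) * ha1
  have hinj : Function.Injective T := by
    rw [injective_iff_map_eq_zero]
    intro x hx
    refine dotProduct_eq_zero x fun y => ?_
    rw [← hiso x y, hx, zero_dotProduct]
  refine ⟨LinearEquiv.ofInjectiveEndo T hinj, fun x y => hiso x y, ?_⟩
  change T v = u
  have hvw : a * (v ⬝ᵥ w) = 1 := by
    rw [hw, dotProduct_sub, hv, dotProduct_comm v u, sub_zero, ha1]
  rw [hT, hvw, one_smul, hw]
  abel

variable [Fintype F]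

lemma ncard_containing_le_of_isotropic (k : ℕ) {u v : Fin n → F} (hu : u ⬝ᵥ u = 0)
    (hv : v ⬝ᵥ v = 0) (huv : u ⬝ᵥ v ≠ 0) :
    {C ∈ selfOrthogonalCodes F n k | v ∈ C}.ncard ≤
      {C ∈ selfOrthogonalCodes F n k | u ∈ C}.ncard := by
  obtain ⟨T, hT, hTv⟩ := exists_isometry hu hv huv
  refine Set.ncard_le_ncard_of_injOn
    (fun C => C.map (T : (Fin n → F) →ₗ[F] (Fin n → F))) ?_ ?_ (Set.toFinite _)
  · rintro C ⟨⟨hCk, hC⟩, hvC⟩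
    refine ⟨⟨?_, ?_⟩, ⟨v, hvC, hTv⟩⟩
    · rw [← hCk]
      exact LinearEquiv.finrank_map_eq T C
    · rw [isSelfOrthogonal_iff] at hC ⊢
      rintro _ ⟨x, hx, rfl⟩ _ ⟨y, hy, rfl⟩
      exact (hT x y).trans (hC x hx y hy)
  · exact (Submodule.map_injective_of_injective T.injective).injOn

/-! ### Codes through a fixed isotropic vector -/

omit [Fintype F] in
lemma exists_isotropic_translate [Finite F] {v : Fin n → F} (hv : v ⬝ᵥ v = 0) {j : Fin n} (hj : v j = 0) :
    ∃ e : Fin n → F, v ⬝ᵥ e = 0 ∧ ∀ w, w ⬝ᵥ v ≠ 0 → ∃ t : F, (w + t • e) ⬝ᵥ (w + t • e) = 0 := by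
  have key : ∀ (w e : Fin n → F) (t : F), (w + t • e) ⬝ᵥ (w + t • e) =
      w ⬝ᵥ w + 2 * t * (w ⬝ᵥ e) + t ^ 2 * (e ⬝ᵥ e) := by
    intro w e t
    simp only [add_dotProduct, dotProduct_add, smul_dotProduct, dotProduct_smul, smul_eq_mul,
      dotProduct_comm e w]
    ring
  by_cases h2 : (2 : F) = 0
  -- In characteristic two `w ⬝ᵥ w` is a square, corrected along a coordinate vector orthogonal to
  -- `v`. The zero coordinate matters: isotropic vectors have coordinate sum zero, so all are
  -- orthogonal to the all-ones vector.
  · refine ⟨Pi.single j 1, by simp [hj], fun w _ => ?_⟩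
    have : CharP F 2 := CharTwo.of_one_ne_zero_of_two_eq_zero one_ne_zero h2
    obtain ⟨t, ht⟩ := FiniteField.isSquare_of_char_two (ringChar.eq_iff.mpr this) (w ⬝ᵥ w)
    refine ⟨t, ?_⟩
    rw [key, ht, h2]
    simp
    linear_combination t * t * h2
  -- In odd characteristic, translating along `v` itself makes the isotropy condition linear in `t`.
  · refine ⟨v, hv, fun w hw => ⟨-(w ⬝ᵥ w) / (2 * (w ⬝ᵥ v)), ?_⟩⟩
    rw [key, hv]
    field_simp
    ring

-- At least half of all vectors pair nontrivially with `v`. Each becomes isotropic after a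
-- translation along a fixed `e` orthogonal to `v`, which preserves that pairing, so `q` translates
-- of `U` cover them.
open scoped Classical in
lemma card_pow_le_card_isotropic_not_orthogonal {v : Fin n → F} (hv0 : v ≠ 0)
    (hv : v ⬝ᵥ v = 0) {j : Fin n} (hj : v j = 0) :
    Fintype.card F ^ n ≤ 2 * Fintype.card F *
      (Finset.univ.filter fun u : Fin n → F => u ⬝ᵥ u = 0 ∧ u ⬝ᵥ v ≠ 0).card := by
  set U := Finset.univ.filter fun u : Fin n → F => u ⬝ᵥ u = 0 ∧ u ⬝ᵥ v ≠ 0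
  set W := Finset.univ.filter fun w : Fin n → F => w ⬝ᵥ v ≠ 0
  obtain ⟨e, hve, he⟩ := exists_isotropic_translate hv hj
  have hWU : W.card ≤ Fintype.card F * U.card := by
    have hsub : W ⊆ (Finset.univ ×ˢ U).image fun p : F × (Fin n → F) => p.2 - p.1 • e := by
      intro w hw
      have hwv : w ⬝ᵥ v ≠ 0 := (Finset.mem_filter.1 hw).2
      obtain ⟨t, ht⟩ := he w hwv
      refine Finset.mem_image.2 ⟨(t, w + t • e), ?_, by simp⟩
      refine Finset.mem_product.2 ⟨Finset.mem_univ _, Finset.mem_filter.2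
        ⟨Finset.mem_univ _, ht, ?_⟩⟩
      rwa [add_dotProduct, smul_dotProduct, dotProduct_comm e v, hve, smul_zero, add_zero]
    calc W.card ≤ _ := Finset.card_le_card hsub
      _ ≤ (Finset.univ ×ˢ U).card := Finset.card_image_le
      _ = _ := by rw [Finset.card_product, Finset.card_univ]
  obtain ⟨i, hi⟩ := Function.ne_iff.1 hv0
  have hcompl : Wᶜ.card ≤ W.card := by
    refine Finset.card_le_card_of_injOn (fun w => w + Pi.single i 1) ?_
      (add_left_injective _).injOn
    intro w hw
    have hwv : w ⬝ᵥ v = 0 := by simpa [W] using hw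
    simpa [W, add_dotProduct, hwv] using hi
  have htot : W.card + Wᶜ.card = Fintype.card F ^ n := by
    rw [Finset.card_add_card_compl, Fintype.card_fun, Fintype.card_fin]
  nlinarith

open scoped Classical in
lemma card_filter_mem_eq {k : ℕ} {C : Submodule F (Fin n → F)} (hC : Module.finrank F C = k) :
    (Finset.univ.filter fun v => v ∈ C).card = Fintype.card F ^ k := by
  rw [← hC, ← Module.card_eq_pow_finrank (K := F) (V := C), Fintype.card_subtype]

/-- The self-orthogonal codes as a finite set. -/
noncomputable def codesFinset (F : Type*) [Field F] [Fintype F] (n k : ℕ) :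
    Finset (Submodule F (Fin n → F)) :=
  (Set.toFinite (selfOrthogonalCodes F n k)).toFinset

lemma mem_codesFinset {k : ℕ} {C : Submodule F (Fin n → F)} :
    C ∈ codesFinset F n k ↔ C ∈ selfOrthogonalCodes F n k :=
  Set.Finite.mem_toFinset _

lemma card_codesFinset (k : ℕ) :
    (codesFinset F n k).card = (selfOrthogonalCodes F n k).ncard :=
  (Set.ncard_eq_toFinset_card _ _).symm

lemma card_filter_codesFinset (k : ℕ) (P : Submodule F (Fin n → F) → Prop) [DecidablePred P] :
    ((codesFinset F n k).filter P).card = {C ∈ selfOrthogonalCodes F n k | P C}.ncard := by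
  rw [← Set.ncard_coe_finset]
  congr 1
  ext C
  simp [mem_codesFinset]

/-- A fixed isotropic vector of weight less than `n` lies in few self-orthogonal codes. -/
lemma ncard_containing_mul_le (k : ℕ) {v : Fin n → F} (hv0 : v ≠ 0) (hv : v ⬝ᵥ v = 0)
    {j : Fin n} (hj : v j = 0) :
    {C ∈ selfOrthogonalCodes F n k | v ∈ C}.ncard * Fintype.card F ^ n ≤
      2 * Fintype.card F ^ (k + 1) * (selfOrthogonalCodes F n k).ncard := by
  classical
  set U := Finset.univ.filter fun u : Fin n → F => u ⬝ᵥ u = 0 ∧ u ⬝ᵥ v ≠ 0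
  set N := {C ∈ selfOrthogonalCodes F n k | v ∈ C}.ncard
  have hU : Fintype.card F ^ n ≤ 2 * Fintype.card F * U.card :=
    card_pow_le_card_isotropic_not_orthogonal hv0 hv hj
  -- Count pairs `u ∈ C` with `u ∈ U`: at least `N` codes per vector, at most `q ^ k` vectors per
  -- code.
  have hcount : U.card * N ≤ (codesFinset F n k).card * Fintype.card F ^ k := by
    refine Finset.card_mul_le_card_mul (fun u C => u ∈ C) (fun u hu => ?_) fun C hC => ?_
    · obtain ⟨-, huu, huv⟩ := Finset.mem_filter.1 hu
      rw [Finset.bipartiteAbove, card_filter_codesFinset]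
      exact ncard_containing_le_of_isotropic k huu hv huv
    · rw [← card_filter_mem_eq (mem_codesFinset.1 hC).1]
      exact Finset.card_le_card (Finset.filter_subset_filter _ (Finset.subset_univ _))
  rw [card_codesFinset] at hcount
  calc N * Fintype.card F ^ n ≤ N * (2 * Fintype.card F * U.card) := Nat.mul_le_mul_left _ hU
    _ = 2 * Fintype.card F * (U.card * N) := by ring
    _ ≤ 2 * Fintype.card F * (_ * Fintype.card F ^ k) := Nat.mul_le_mul_left _ hcount
    _ = _ := by ring

/-! ### Isotropic vectors and codes of small weight -/

open scoped Classical in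
lemma card_isotropic_supported_le {S : Finset (Fin n)} {i : Fin n} (hi : i ∈ S) :
    (Finset.univ.filter fun v : Fin n → F => v ⬝ᵥ v = 0 ∧ ∀ j ∉ S, v j = 0).card ≤
      2 * Fintype.card F ^ (S.card - 1) := by
  set V := Finset.univ.filter fun v : Fin n → F => v ⬝ᵥ v = 0 ∧ ∀ j ∉ S, v j = 0
  -- Fixing the coordinates in `S` other than `i` also fixes `v i * v i`, which leaves at most two
  -- values of `v i`.
  have hfib : ∀ b ∈ (Finset.univ : Finset (↥(S.erase i) → F)),
      (V.filter fun v => (fun j : ↥(S.erase i) => v j) = b).card ≤ 2 := by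
    intro b _
    rcases Finset.eq_empty_or_nonempty
      (V.filter fun v => (fun j : ↥(S.erase i) => v j) = b) with h | ⟨v₀, hv₀⟩
    · simp [h]
    · refine (Finset.card_le_card (t := {v₀, Function.update v₀ i (-v₀ i)}) ?_).trans
        Finset.card_le_two
      intro v hv
      simp only [V, Finset.mem_filter, Finset.mem_univ, true_and] at hv hv₀
      obtain ⟨⟨hvv, hvS⟩, hvb⟩ := hv
      obtain ⟨⟨hvv₀, hvS₀⟩, hvb₀⟩ := hv₀
      have hoff : ∀ j, j ≠ i → v j = v₀ j := by
        intro j hj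
        by_cases hjS : j ∈ S
        · exact congrFun (hvb.trans hvb₀.symm) ⟨j, Finset.mem_erase.2 ⟨hj, hjS⟩⟩
        · rw [hvS j hjS, hvS₀ j hjS]
      have hsq : v i * v i = v₀ i * v₀ i := by
        rw [dotProduct, ← Finset.add_sum_erase _ _ (Finset.mem_univ i)] at hvv hvv₀
        have : ∑ j ∈ Finset.univ.erase i, v j * v j = ∑ j ∈ Finset.univ.erase i, v₀ j * v₀ j :=
          Finset.sum_congr rfl fun j hj => by rw [hoff j (Finset.ne_of_mem_erase hj)]
        rw [this] at hvv
        exact add_right_cancel (hvv.trans hvv₀.symm)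
      rw [Finset.mem_insert, Finset.mem_singleton]
      rcases mul_self_eq_mul_self_iff.1 hsq with h | h
      · left
        ext j
        rcases eq_or_ne j i with rfl | hj
        exacts [h, hoff j hj]
      · right
        ext j
        rcases eq_or_ne j i with rfl | hj
        · rw [h, Function.update_self]
        · rw [Function.update_of_ne hj, hoff j hj]
  refine (Finset.card_le_mul_card_image_of_maps_to (fun v _ => Finset.mem_univ _) 2 hfib).trans ?_
  rw [Finset.card_univ, Fintype.card_fun, Fintype.card_coe, Finset.card_erase_of_mem hi]

open scoped Classical in
lemma card_light_isotropic_le {m : ℕ} (hm : 1 ≤ m) (hmn : m ≤ n) :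
    (Finset.univ.filter fun v : Fin n → F => v ⬝ᵥ v = 0 ∧ hammingNorm v ≤ m).card ≤
      n.choose m * (2 * Fintype.card F ^ (m - 1)) := by
  have hsub : (Finset.univ.filter fun v : Fin n → F => v ⬝ᵥ v = 0 ∧ hammingNorm v ≤ m) ⊆
      (Finset.powersetCard m Finset.univ).biUnion fun S =>
        Finset.univ.filter fun v : Fin n → F => v ⬝ᵥ v = 0 ∧ ∀ j ∉ S, v j = 0 := by
    intro v hv
    simp only [Finset.mem_filter, Finset.mem_univ, true_and] at hv
    obtain ⟨S, hS, -, hSm⟩ := Finset.exists_subsuperset_card_eq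
      (Finset.subset_univ (Finset.univ.filter fun j => v j ≠ 0)) (n := m)
      (by simpa [hammingNorm] using hv.2) (by simpa using hmn)
    refine Finset.mem_biUnion.2 ⟨S, Finset.mem_powersetCard.2 ⟨Finset.subset_univ _, hSm⟩, ?_⟩
    refine Finset.mem_filter.2 ⟨Finset.mem_univ _, hv.1, fun j hj => ?_⟩
    by_contra h
    exact hj (hS (Finset.mem_filter.2 ⟨Finset.mem_univ _, h⟩))
  refine (Finset.card_le_card hsub).trans ?_
  have := Finset.card_biUnion_le_card_mul (Finset.powersetCard m (Finset.univ : Finset (Fin n)))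
    (fun S => Finset.univ.filter fun v : Fin n → F => v ⬝ᵥ v = 0 ∧ ∀ j ∉ S, v j = 0)
    (2 * Fintype.card F ^ (m - 1)) ?_
  · rwa [Finset.card_powersetCard, Finset.card_univ, Fintype.card_fin] at this
  · intro S hS
    obtain ⟨-, rfl⟩ := Finset.mem_powersetCard.1 hS
    obtain ⟨i, hi⟩ := Finset.card_pos.1 hm
    exact card_isotropic_supported_le hi

open scoped Classical in
lemma ncard_light_mul_le {k m : ℕ} (hm : 1 ≤ m) (hmn : m < n) (hk : 1 ≤ k) :
    {C ∈ selfOrthogonalCodes F n k | minDist C ≤ m}.ncard * Fintype.card F ^ (n + 1) ≤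
      8 * n.choose m * Fintype.card F ^ (m + k) * (selfOrthogonalCodes F n k).ncard := by
  set q := Fintype.card F
  set σ := (selfOrthogonalCodes F n k).ncard
  have hq : 1 < q := Fintype.one_lt_card
  set M := 2 * q ^ (k + 1) * σ / q ^ n
  set V := Finset.univ.filter fun v : Fin n → F => v ⬝ᵥ v = 0 ∧ hammingNorm v ≤ m
  have hV : V.card ≤ n.choose m * (2 * q ^ (m - 1)) := card_light_isotropic_le hm hmn.le
  set B := (codesFinset F n k).filter fun C => minDist C ≤ m
  have hB : B.card = {C ∈ selfOrthogonalCodes F n k | minDist C ≤ m}.ncard :=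
    card_filter_codesFinset k _
  -- Each bad code contains the `q - 1` nonzero multiples of one light word; each light vector lies
  -- in at most `M` codes.
  have hcount : B.card * (q - 1) ≤ (V.erase 0).card * M := by
    refine Finset.card_mul_le_card_mul (fun C v => v ∈ C) (fun C hC => ?_) fun v hv => ?_
    · obtain ⟨hC, hCm⟩ := Finset.mem_filter.1 hC
      obtain ⟨hCk, hCs⟩ := mem_codesFinset.1 hC
      rw [isSelfOrthogonal_iff] at hCs
      have hne : {m : ℕ | ∃ v ∈ C, v ≠ 0 ∧ hammingNorm v = m}.Nonempty := by
        have hbot : C ≠ ⊥ := by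
          rintro rfl
          rw [finrank_bot] at hCk
          omega
        obtain ⟨v, hv, hv0⟩ := C.ne_bot_iff.1 hbot
        exact ⟨_, v, hv, hv0, rfl⟩
      obtain ⟨v, hvC, hv0, hvm⟩ := Nat.sInf_mem hne
      have hvm : hammingNorm v ≤ m := by
        refine le_trans (le_of_eq ?_) hCm
        rw [minDist, ← hvm]
      have hunits : Fintype.card Fˣ = q - 1 := Fintype.card_units F
      rw [← hunits, ← Finset.card_univ]
      refine Finset.card_le_card_of_injOn (fun c : Fˣ => (c : F) • v) (fun c _ => ?_) ?_
      · refine Finset.mem_filter.2 ⟨Finset.mem_erase.2 ⟨smul_ne_zero c.ne_zero hv0,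
          Finset.mem_filter.2 ⟨Finset.mem_univ _, ?_, ?_⟩⟩, C.smul_mem _ hvC⟩
        · rw [smul_dotProduct, dotProduct_smul, hCs v hvC v hvC, smul_zero, smul_zero]
        · exact hammingNorm_smul_le_hammingNorm.trans hvm
      · intro c _ c' _ h
        exact Units.ext (smul_left_injective F hv0 h)
    · obtain ⟨hv0, hv⟩ := Finset.mem_erase.1 hv
      obtain ⟨-, hvv, hvm⟩ := Finset.mem_filter.1 hv
      obtain ⟨j, hj⟩ : ∃ j, v j = 0 := by
        by_contra! h
        have : hammingNorm v = n := by simp [hammingNorm, h]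
        omega
      rw [Finset.bipartiteBelow, Nat.le_div_iff_mul_le (by positivity)]
      refine le_trans (Nat.mul_le_mul_right _ ?_) (ncard_containing_mul_le k hv0 hvv hj)
      rw [← card_filter_codesFinset]
      exact Finset.card_le_card (Finset.filter_subset_filter _ (Finset.filter_subset _ _))
  have hM : M * q ^ n ≤ 2 * q ^ (k + 1) * σ := Nat.div_mul_le_self _ _
  have hVe : (V.erase 0).card ≤ n.choose m * (2 * q ^ (m - 1)) :=
    (Finset.card_le_card (Finset.erase_subset _ _)).trans hV
  -- Replacing `q - 1` by `q` costs a factor 2; with the 2 in `hV` and the 2 in `M` this gives the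
  -- 8.
  have hq2 : q ≤ 2 * (q - 1) := by omega
  have hpow : q ^ (m - 1) * q ^ (k + 1) = q ^ (m + k) := by
    rw [← pow_add]
    congr 1
    omega
  rw [← hB]
  calc B.card * q ^ (n + 1) = B.card * q * q ^ n := by ring
    _ ≤ B.card * (2 * (q - 1)) * q ^ n := by gcongr
    _ = 2 * (B.card * (q - 1)) * q ^ n := by ring
    _ ≤ 2 * (n.choose m * (2 * q ^ (m - 1)) * M) * q ^ n :=
      Nat.mul_le_mul_right _ (Nat.mul_le_mul_left _
        (hcount.trans (Nat.mul_le_mul_right _ hVe)))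
    _ = 4 * n.choose m * q ^ (m - 1) * (M * q ^ n) := by ring
    _ ≤ 4 * n.choose m * q ^ (m - 1) * (2 * q ^ (k + 1) * σ) := by gcongr
    _ = 8 * n.choose m * (q ^ (m - 1) * q ^ (k + 1)) * σ := by ring
    _ = _ := by rw [hpow]

lemma proportion_minDist_le {k m : ℕ} (hm : 1 ≤ m) (hmn : m < n) (hk : 1 ≤ k) :
    proportion F n k (fun C => minDist C ≤ m) ≤
      8 * (n.choose m : ℝ) * (Fintype.card F : ℝ) ^ ((m : ℤ) + k - n - 1) := by
  have hq : (0 : ℝ) < Fintype.card F := by exact_mod_cast Fintype.card_pos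
  -- This also covers the case of no codes, where the quotient is `0 / 0 = 0`.
  refine div_le_of_le_mul₀ (Nat.cast_nonneg _) (by positivity) ?_
  have hexp : (m : ℤ) + k - n - 1 = ((m + k : ℕ) : ℤ) - ((n + 1 : ℕ) : ℤ) := by
    push_cast
    ring
  rw [hexp, zpow_sub₀ hq.ne', zpow_natCast, zpow_natCast, mul_div_assoc', div_mul_eq_mul_div,
    le_div_iff₀ (by positivity)]
  exact_mod_cast ncard_light_mul_le (F := F) hm hmn hk

/-! ### MDS codes -/

omit [Fintype F] in
/-- The Singleton bound. -/
lemma minDist_le {C : Submodule F (Fin n → F)} (hC : 1 ≤ Module.finrank F C) :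
    minDist C ≤ n - Module.finrank F C + 1 := by
  set k := Module.finrank F C
  have hkn : k ≤ n := by simpa using Submodule.finrank_le C
  -- Restriction to the first `k - 1` coordinates has a nonzero kernel on `C`, hence a nonzero
  -- codeword vanishing there.
  let φ : C →ₗ[F] (Fin (k - 1) → F) :=
    (LinearMap.funLeft F F (Fin.castLE (by omega : k - 1 ≤ n))).comp C.subtype
  obtain ⟨⟨v, hvC⟩, hvφ, hv0⟩ := φ.ker.ne_bot_iff.1
    (LinearMap.ker_ne_bot_of_finrank_lt (f := φ) (by rw [Module.finrank_fin_fun]; omega))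
  have hv0 : v ≠ 0 := fun h => hv0 (Subtype.ext h)
  have hvz : ∀ j : Fin (k - 1), v (Fin.castLE (by omega) j) = 0 := fun j => congrFun hvφ j
  refine le_trans (Nat.sInf_le ⟨v, hvC, hv0, rfl⟩) ?_
  classical
  set Z := (Finset.univ : Finset (Fin (k - 1))).map (Fin.castLEEmb (by omega : k - 1 ≤ n))
  have hZ : Z.card = k - 1 := by simp [Z]
  have hsub : (Finset.univ.filter fun j => v j ≠ 0) ⊆ Zᶜ := by
    intro j hj
    rw [Finset.mem_compl]
    intro hjZ
    obtain ⟨i, -, rfl⟩ := Finset.mem_map.1 hjZ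
    exact (Finset.mem_filter.1 hj).2 (hvz i)
  have := Finset.card_le_card hsub
  rw [Finset.card_compl, hZ, Fintype.card_fin] at this
  have hw : hammingNorm v = (Finset.univ.filter fun j => v j ≠ 0).card := by
    simp [hammingNorm]
  convert (hw.le.trans this).trans (show n - (k - 1) ≤ n - k + 1 by omega)

omit [Fintype F] in
lemma selfOrthogonalCodes_nonempty {k : ℕ} (hk : k ≤ wittIndex F n) :
    (selfOrthogonalCodes F n k).Nonempty := by
  obtain ⟨C, hC, hCw⟩ := Nat.sSup_mem (s := {m : ℕ | ∃ C : Submodule F (Fin n → F),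
    IsSelfOrthogonal C ∧ Module.finrank F C = m})
    ⟨0, ⊥, bot_le, finrank_bot _ _⟩
    ⟨n, by rintro _ ⟨C, -, rfl⟩; simpa using Submodule.finrank_le C⟩
  obtain ⟨D, hDC, hD⟩ : ∃ D ≤ C, Module.finrank F D = k := by
    obtain ⟨f, hf⟩ := exists_linearIndependent_of_le_finrank (R := F) (M := C) (hk.trans hCw.ge)
    refine ⟨(Submodule.span F (Set.range f)).map C.subtype, Submodule.map_subtype_le _ _, ?_⟩
    rw [Submodule.finrank_map_subtype_eq, finrank_span_eq_card hf, Fintype.card_fin]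
  rw [isSelfOrthogonal_iff] at hC
  exact ⟨D, hD, isSelfOrthogonal_iff.2 fun v hv w hw => hC v (hDC hv) w (hDC hw)⟩

/-- By the Singleton bound a code that is not MDS has `minDist C ≤ n - k`; for this weight the
exponent is exactly `-1`. -/
lemma abs_proportion_isMDS_sub_one_le {k : ℕ} (hk : 1 ≤ k) (hkn : k < n)
    (hkw : k ≤ wittIndex F n) :
    |proportion F n k IsMDS - 1| ≤
      8 * (n.choose (n - k) : ℝ) * (Fintype.card F : ℝ)⁻¹ := by
  have hσ : (0 : ℝ) < (selfOrthogonalCodes F n k).ncard := by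
    exact_mod_cast (Set.ncard_pos).2 (selfOrthogonalCodes_nonempty hkw)
  have hcover : selfOrthogonalCodes F n k ⊆ {C ∈ selfOrthogonalCodes F n k | IsMDS C} ∪
      {C ∈ selfOrthogonalCodes F n k | minDist C ≤ n - k} := by
    intro C hC
    have hCk : Module.finrank F C = k := hC.1
    by_cases h : minDist C ≤ n - k
    · exact Or.inr ⟨hC, h⟩
    · refine Or.inl ⟨hC, ?_, ?_⟩
      · rintro rfl
        rw [finrank_bot] at hCk
        omega
      · have := minDist_le (C := C) (by omega)
        rw [hCk] at this ⊢
        omega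
  have hle : ((selfOrthogonalCodes F n k).ncard : ℝ) ≤
      ({C ∈ selfOrthogonalCodes F n k | IsMDS C}.ncard : ℝ) +
        ({C ∈ selfOrthogonalCodes F n k | minDist C ≤ n - k}.ncard : ℝ) := by
    exact_mod_cast (Set.ncard_le_ncard hcover).trans (Set.ncard_union_le _ _)
  have hsum : 1 ≤ proportion F n k IsMDS + proportion F n k (fun C => minDist C ≤ n - k) := by
    rw [proportion, proportion, ← add_div]
    exact (one_le_div hσ).2 hle
  have hone : proportion F n k IsMDS ≤ 1 := by
    refine (div_le_one hσ).2 ?_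
    exact_mod_cast Set.ncard_le_ncard (Set.sep_subset _ _)
  have hbad := proportion_minDist_le (F := F) (n := n) (m := n - k) (by omega) (by omega) hk
  rw [show ((n - k : ℕ) : ℤ) + k - n - 1 = -1 by omega, zpow_neg_one] at hbad
  rw [abs_sub_comm, abs_of_nonneg (by linarith)]
  linarith

end

end SelfOrthogonalCodes

theorem mainTheorem5 (n d k : ℕ) (hd : 4 ≤ d) (hdn : d < n) (hk : 1 ≤ k)
    (hkd : k ≤ n - d + 1) :
    (∃ c : ℝ, ∃ Q : ℕ, ∀ (F : Type*) [Field F] [Fintype F], Q ≤ Fintype.card F →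
      k ≤ SelfOrthogonalCodes.wittIndex F n →
      SelfOrthogonalCodes.proportion F n k
          (fun C => SelfOrthogonalCodes.minDist C ≤ d - 1) ≤
        c * (Fintype.card F : ℝ) ^ ((d : ℤ) + (k : ℤ) - (n : ℤ) - 2)) ∧
    (∀ ε : ℝ, 0 < ε → ∃ Q : ℕ, ∀ (F : Type*) [Field F] [Fintype F], Q ≤ Fintype.card F →
      k ≤ SelfOrthogonalCodes.wittIndex F n →
      |SelfOrthogonalCodes.proportion F n k SelfOrthogonalCodes.IsMDS - 1| < ε) := by
  refine ⟨⟨8 * n.choose (d - 1), 0, fun F _ _ _ _ => ?_⟩, fun ε hε => ?_⟩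
  · have h := SelfOrthogonalCodes.proportion_minDist_le (F := F) (n := n) (m := d - 1)
      (by omega) (by omega) hk
    rwa [show ((d - 1 : ℕ) : ℤ) + k - n - 1 = (d : ℤ) + k - n - 2 by omega] at h
  · obtain ⟨Q, hQ⟩ := exists_nat_gt (8 * (n.choose (n - k) : ℝ) / ε)
    refine ⟨Q, fun F _ _ hF hkw => ?_⟩
    have hq : (0 : ℝ) < Fintype.card F := by exact_mod_cast Fintype.card_pos
    refine (SelfOrthogonalCodes.abs_proportion_isMDS_sub_one_le hk (by omega) hkw).trans_lt ?_
    rw [← div_eq_mul_inv, div_lt_iff₀ hq, ← div_lt_iff₀' hε]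
    exact hQ.trans_le (by exact_mod_cast hF)
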